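/- For $0\le q<1$ let $C(D_q)$ (the quantum disk) be the universal unital $C^*$-algebra generated by an element $z$ and its adjoint $\bar z=z^*$ subject to the relation $\bar z z=q\,z\bar z+(1-q)$; that is, the completion, modulo the null space, of the $*$-algebra of noncommutative polynomials $a$ in $z,\bar z$ with respect to the seminorm $\|a\|=\sup_\rho\|\rho(a)\|$, the supremum being over all representations $\rho$ of the relation by bounded operators on complex Hilbert spaces. Let $\mathfrak T=C^*(V)$ be the Toeplitz algebra, i.e. the $C^*$-algebra of bounded operators on $\ell^2$ generated by the unilateral shift $V$, $Ve_n=e_{n+1}$, $n=0,1,2,\dots$. Proposition. For every $0\le q<1$ there is a $*$-isomorphism $C(D_q)\cong\mathfrak T$. In particular the $C^*$-algebras $C(D_q)$, $0\le q<1$, are all isomorphic to each other. -/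

import Mathlib

open UniformSpace

universe u

noncomputable section

/-! ### The free complex `*`-algebra on one generator `z` (polynomials in `z` and its adjoint) -/

/-- The two letters `z` and `z̄`. -/
inductive DiskGen : Type
  | z : DiskGen
  | zbar : DiskGen

/-- Exchange of the letters `z` and `z̄`. -/
def DiskGen.conj : DiskGen → DiskGen
  | .z => .zbar
  | .zbar => .z

/-- The ring homomorphism underlying the involution of `ℂ⟨z, z̄⟩`: it is conjugate linear, reverses
products and exchanges `z` and `z̄`. It is obtained from the universal property of the free algebra,
with `ℂ` acting on the opposite algebra through complex conjugation. -/
def freeDiskConj : FreeAlgebra ℂ DiskGen →+* (FreeAlgebra ℂ DiskGen)ᵐᵒᵖ :=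
  letI : Algebra ℂ (FreeAlgebra ℂ DiskGen)ᵐᵒᵖ :=
    RingHom.toAlgebra' ((algebraMap ℂ (FreeAlgebra ℂ DiskGen)ᵐᵒᵖ).comp (starRingEnd ℂ))
      (fun c x => Algebra.commutes (starRingEnd ℂ c) x)
  (FreeAlgebra.lift ℂ (A := (FreeAlgebra ℂ DiskGen)ᵐᵒᵖ)
    (fun g : DiskGen => MulOpposite.op (FreeAlgebra.ι ℂ g.conj))).toRingHom

theorem freeDiskConj_ι (g : DiskGen) :
    freeDiskConj (FreeAlgebra.ι ℂ g) = MulOpposite.op (FreeAlgebra.ι ℂ g.conj) := by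
  simp [freeDiskConj]

theorem freeDiskConj_algebraMap (c : ℂ) :
    freeDiskConj (algebraMap ℂ _ c) = MulOpposite.op (algebraMap ℂ _ (starRingEnd ℂ c)) := by
  let : Algebra ℂ (FreeAlgebra ℂ DiskGen)ᵐᵒᵖ :=
    RingHom.toAlgebra' ((algebraMap ℂ (FreeAlgebra ℂ DiskGen)ᵐᵒᵖ).comp (starRingEnd ℂ))
      (fun c x => Algebra.commutes (starRingEnd ℂ c) x)
  exact (FreeAlgebra.lift ℂ (A := (FreeAlgebra ℂ DiskGen)ᵐᵒᵖ)
    (fun g : DiskGen => MulOpposite.op (FreeAlgebra.ι ℂ g.conj))).commutes c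

/-! ### Hilbert space representations -/

/-- A representation of the relation `z̄ z = q z z̄ + (1 - q)` on a complex Hilbert space: the bounded
operator `T` is the image of `z`, its adjoint `star T` the image of `z̄`. -/
structure DiskRep (q : ℝ) : Type (u + 1) where
  /-- the Hilbert space -/
  H : Type u
  [normed : NormedAddCommGroup H]
  [inner : InnerProductSpace ℂ H]
  [complete : CompleteSpace H]
  /-- the image of `z` -/
  T : H →L[ℂ] H
  rel : star T * T = (q : ℂ) • (T * star T) + ((1 - q : ℝ) : ℂ) • 1

attribute [instance] DiskRep.normed DiskRep.inner DiskRep.complete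

namespace DiskRep

variable {q : ℝ}

/-- The value `ρ(a)` of a polynomial `a` in `z`, `z̄` under a representation `ρ`. -/
def eval (ρ : DiskRep.{u} q) : FreeAlgebra ℂ DiskGen →ₐ[ℂ] (ρ.H →L[ℂ] ρ.H) :=
  FreeAlgebra.lift ℂ (fun g => match g with
    | .z => ρ.T
    | .zbar => star ρ.T)

theorem eval_z (ρ : DiskRep.{u} q) : ρ.eval (FreeAlgebra.ι ℂ .z) = ρ.T := by simp [eval]

theorem eval_zbar (ρ : DiskRep.{u} q) : ρ.eval (FreeAlgebra.ι ℂ .zbar) = star ρ.T := by simp [eval]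

theorem eval_conj (ρ : DiskRep.{u} q) (a : FreeAlgebra ℂ DiskGen) :
    ρ.eval (freeDiskConj a).unop = star (ρ.eval a) := by
  induction a using FreeAlgebra.induction with
  | grade0 c =>
    rw [freeDiskConj_algebraMap, MulOpposite.unop_op, AlgHom.commutes, AlgHom.commutes,
      Algebra.algebraMap_eq_smul_one, Algebra.algebraMap_eq_smul_one, star_smul, star_one]
    rfl
  | grade1 g =>
    rw [freeDiskConj_ι, MulOpposite.unop_op]
    cases g
    · rw [DiskGen.conj, eval_z, eval_zbar]
    · rw [DiskGen.conj, eval_z, eval_zbar, star_star]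
  | mul a b ha hb => rw [map_mul, MulOpposite.unop_mul, map_mul, map_mul, ha, hb, star_mul]
  | add a b ha hb => rw [map_add, MulOpposite.unop_add, map_add, map_add, ha, hb, star_add]

/-- The zero-dimensional representation; there is always at least one representation. -/
instance : Nonempty (DiskRep.{u} q) := ⟨{ H := PUnit, T := 0, rel := Subsingleton.elim _ _ }⟩

theorem norm_T_le_one (hq0 : 0 ≤ q) (hq1 : q < 1) (ρ : DiskRep.{u} q) : ‖ρ.T‖ ≤ 1 := by
  have h1 : ‖star ρ.T * ρ.T‖ ≤ q * (‖ρ.T‖ * ‖ρ.T‖) + (1 - q) * 1 := by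
    rw [ρ.rel]
    refine (norm_add_le _ _).trans (add_le_add ?_ ?_)
    · rw [norm_smul, CStarRing.norm_self_mul_star, Complex.norm_real, Real.norm_of_nonneg hq0]
    · rw [norm_smul, Complex.norm_real, Real.norm_of_nonneg (by linarith)]
      exact mul_le_mul_of_nonneg_left ContinuousLinearMap.norm_id_le (by linarith)
  rw [CStarRing.norm_star_mul_self] at h1
  by_contra! h
  nlinarith [mul_pos (sub_pos.mpr hq1) (sub_pos.mpr h), mul_pos (sub_pos.mpr hq1)
    (mul_pos (sub_pos.mpr h) (sub_pos.mpr h))]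

theorem exists_bound (hq0 : 0 ≤ q) (hq1 : q < 1) (a : FreeAlgebra ℂ DiskGen) :
    ∃ C : ℝ, ∀ ρ : DiskRep.{u} q, ‖ρ.eval a‖ ≤ C := by
  induction a using FreeAlgebra.induction with
  | grade0 c =>
    refine ⟨‖c‖ * 1, fun ρ => ?_⟩
    rw [AlgHom.commutes, Algebra.algebraMap_eq_smul_one, norm_smul]
    exact mul_le_mul_of_nonneg_left ContinuousLinearMap.norm_id_le (norm_nonneg c)
  | grade1 g =>
    refine ⟨1, fun ρ => ?_⟩
    cases g
    · rw [eval_z]; exact ρ.norm_T_le_one hq0 hq1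
    · rw [eval_zbar, norm_star]; exact ρ.norm_T_le_one hq0 hq1
  | mul a b ha hb =>
    obtain ⟨A, hA⟩ := ha
    obtain ⟨B, hB⟩ := hb
    refine ⟨A * B, fun ρ => ?_⟩
    rw [map_mul]
    exact (norm_mul_le _ _).trans
      (mul_le_mul (hA ρ) (hB ρ) (norm_nonneg _) ((norm_nonneg _).trans (hA ρ)))
  | add a b ha hb =>
    obtain ⟨A, hA⟩ := ha
    obtain ⟨B, hB⟩ := hb
    refine ⟨A + B, fun ρ => ?_⟩
    rw [map_add]
    exact (norm_add_le _ _).trans (add_le_add (hA ρ) (hB ρ))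

end DiskRep

/-! ### The universal C*-algebra -/

/-- The `*`-algebra of polynomials in `z`, `z̄`, to be equipped with the universal C*-seminorm for the
relation with parameter `q ∈ [0, 1)`, taken over all representations on Hilbert spaces in `Type u`.
As a type this is just the free algebra `ℂ⟨z, z̄⟩`; the constant function only tags it with the family
of representations that defines the seminorm. -/
def DiskPoly (q : Set.Ico (0 : ℝ) 1) : Type :=
  Function.const (Type (u + 1)) (FreeAlgebra ℂ DiskGen) (DiskRep.{u} (q : ℝ))

namespace DiskPoly

variable {q : Set.Ico (0 : ℝ) 1}

instance : Ring (DiskPoly.{u} q) := inferInstanceAs (Ring (FreeAlgebra ℂ DiskGen))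

instance : Algebra ℂ (DiskPoly.{u} q) := inferInstanceAs (Algebra ℂ (FreeAlgebra ℂ DiskGen))

/-- The value of a polynomial in a representation. -/
def eval (ρ : DiskRep.{u} (q : ℝ)) : DiskPoly.{u} q →ₐ[ℂ] (ρ.H →L[ℂ] ρ.H) := ρ.eval

/-- The involution: conjugate linear, product reversing, `z ↦ z̄`, `z̄ ↦ z`. -/
instance : StarRing (DiskPoly.{u} q) where
  star a := (freeDiskConj a).unop
  star_involutive a := by
    change (freeDiskConj (freeDiskConj a).unop).unop = a
    induction a using FreeAlgebra.induction with
    | grade0 c => simp [freeDiskConj_algebraMap]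
    | grade1 g => cases g <;> simp [freeDiskConj_ι, DiskGen.conj]
    | mul a b ha hb => rw [map_mul, MulOpposite.unop_mul, map_mul, MulOpposite.unop_mul, ha, hb]
    | add a b ha hb => rw [map_add, MulOpposite.unop_add, map_add, MulOpposite.unop_add, ha, hb]
  star_mul a b := congrArg MulOpposite.unop (map_mul freeDiskConj a b)
  star_add a b := congrArg MulOpposite.unop (map_add freeDiskConj a b)

theorem eval_star (ρ : DiskRep.{u} (q : ℝ)) (a : DiskPoly.{u} q) :
    eval ρ (star a) = star (eval ρ a) := ρ.eval_conj a

instance : StarModule ℂ (DiskPoly.{u} q) where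
  star_smul c a := by
    rw [Algebra.smul_def, star_mul, Algebra.smul_def, Algebra.commutes (star c)]
    exact congrArg (star a * ·) (congrArg MulOpposite.unop (freeDiskConj_algebraMap c))

/-- The universal norm of a polynomial: the supremum of `‖ρ(a)‖` over all Hilbert space
representations `ρ`. -/
def universalNorm (a : DiskPoly.{u} q) : ℝ := ⨆ ρ : DiskRep.{u} (q : ℝ), ‖eval ρ a‖

theorem bddAbove (a : DiskPoly.{u} q) :
    BddAbove (Set.range fun ρ : DiskRep.{u} (q : ℝ) => ‖eval ρ a‖) := by
  obtain ⟨C, hC⟩ := DiskRep.exists_bound.{u} q.2.1 q.2.2 a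
  exact ⟨C, by rintro _ ⟨ρ, rfl⟩; exact hC ρ⟩

theorem norm_eval_le_universalNorm (ρ : DiskRep.{u} (q : ℝ)) (a : DiskPoly.{u} q) :
    ‖eval ρ a‖ ≤ universalNorm a := le_ciSup (bddAbove a) ρ

theorem universalNorm_nonneg (a : DiskPoly.{u} q) : 0 ≤ universalNorm a :=
  Real.iSup_nonneg fun _ => norm_nonneg _

/-- The universal norm as a ring seminorm. -/
def ringSeminorm (q : Set.Ico (0 : ℝ) 1) : RingSeminorm (DiskPoly.{u} q) where
  toFun := universalNorm
  map_zero' := le_antisymm (ciSup_le fun ρ => by simp) (universalNorm_nonneg 0)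
  add_le' a b := ciSup_le fun ρ => by
    rw [map_add]
    exact (norm_add_le _ _).trans
      (add_le_add (norm_eval_le_universalNorm ρ a) (norm_eval_le_universalNorm ρ b))
  neg' a := congrArg iSup (funext fun ρ => by rw [map_neg, norm_neg])
  mul_le' a b := ciSup_le fun ρ => by
    rw [map_mul]
    exact (norm_mul_le _ _).trans
      (mul_le_mul (norm_eval_le_universalNorm ρ a) (norm_eval_le_universalNorm ρ b)
        (norm_nonneg _) (universalNorm_nonneg a))

instance : SeminormedRing (DiskPoly.{u} q) := (ringSeminorm.{u} q).toSeminormedRing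

theorem norm_def (a : DiskPoly.{u} q) : ‖a‖ = ⨆ ρ : DiskRep.{u} (q : ℝ), ‖eval ρ a‖ := rfl

theorem norm_eval_le (ρ : DiskRep.{u} (q : ℝ)) (a : DiskPoly.{u} q) : ‖eval ρ a‖ ≤ ‖a‖ :=
  norm_eval_le_universalNorm ρ a

theorem norm_le {a : DiskPoly.{u} q} {C : ℝ} (h : ∀ ρ : DiskRep.{u} (q : ℝ), ‖eval ρ a‖ ≤ C) :
    ‖a‖ ≤ C := ciSup_le h

instance : NormedAlgebra ℂ (DiskPoly.{u} q) where
  norm_smul_le c a := norm_le fun ρ => by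
    rw [map_smul, norm_smul]
    exact mul_le_mul_of_nonneg_left (norm_eval_le ρ a) (norm_nonneg c)

theorem norm_star_mul_self_eq (a : DiskPoly.{u} q) : ‖star a * a‖ = ‖a‖ * ‖a‖ := by
  apply le_antisymm
  · refine norm_le fun ρ => ?_
    rw [map_mul, eval_star, CStarRing.norm_star_mul_self]
    exact mul_self_le_mul_self (norm_nonneg _) (norm_eval_le ρ a)
  · have h : ‖a‖ ≤ Real.sqrt ‖star a * a‖ := norm_le fun ρ => by
      apply Real.le_sqrt_of_sq_le
      rw [sq, ← CStarRing.norm_star_mul_self, ← eval_star, ← map_mul]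
      exact norm_eval_le ρ _
    calc ‖a‖ * ‖a‖ ≤ Real.sqrt ‖star a * a‖ * Real.sqrt ‖star a * a‖ :=
          mul_self_le_mul_self (norm_nonneg a) h
      _ = ‖star a * a‖ := Real.mul_self_sqrt (norm_nonneg _)

instance : NormedStarGroup (DiskPoly.{u} q) where
  norm_star_le a := norm_le fun ρ => by
    rw [eval_star, norm_star]
    exact norm_eval_le ρ a

end DiskPoly

/-- The quantum disk `C(D_q)`: the universal unital C*-algebra generated by `z`, `z̄ = z*` subject to
`z̄ z = q z z̄ + (1 - q)`, i.e. the separated completion of the polynomials in `z`, `z̄` (the null space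
of the seminorm is divided out) in the universal seminorm. -/
abbrev QuantumDisk (q : Set.Ico (0 : ℝ) 1) : Type := Completion (DiskPoly.{u} q)

namespace QuantumDisk

variable {q : Set.Ico (0 : ℝ) 1}

/-- The involution of the polynomials, extended by continuity. -/
instance : Star (QuantumDisk.{u} q) where
  star := Completion.map (star : DiskPoly.{u} q → DiskPoly.{u} q)

theorem uniformContinuous_star_poly :
    UniformContinuous (star : DiskPoly.{u} q → DiskPoly.{u} q) :=
  (starₗᵢ ℂ : DiskPoly.{u} q ≃ₗᵢ⋆[ℂ] DiskPoly.{u} q).isometry.uniformContinuous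

theorem coe_star (a : DiskPoly.{u} q) : star (a : QuantumDisk.{u} q) = ((star a : DiskPoly.{u} q)) :=
  Completion.map_coe uniformContinuous_star_poly a

theorem continuous_star' : Continuous (star : QuantumDisk.{u} q → QuantumDisk.{u} q) :=
  Completion.continuous_map

instance : StarRing (QuantumDisk.{u} q) where
  star_involutive x := by
    refine Completion.induction_on x
      (isClosed_eq (continuous_star'.comp continuous_star') continuous_id) fun a => ?_
    rw [coe_star, coe_star, star_star]
  star_mul x y := by
    refine Completion.induction_on₂ x y
      (isClosed_eq (continuous_star'.comp continuous_mul)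
        ((continuous_star'.comp continuous_snd).mul (continuous_star'.comp continuous_fst)))
      fun a b => ?_
    rw [← Completion.coe_mul, coe_star, coe_star, coe_star, ← Completion.coe_mul, star_mul]
  star_add x y := by
    refine Completion.induction_on₂ x y
      (isClosed_eq (continuous_star'.comp continuous_add)
        ((continuous_star'.comp continuous_fst).add (continuous_star'.comp continuous_snd)))
      fun a b => ?_
    rw [← Completion.coe_add, coe_star, coe_star, coe_star, ← Completion.coe_add, star_add]

instance : StarModule ℂ (QuantumDisk.{u} q) where
  star_smul c x := by
    refine Completion.induction_on x
      (isClosed_eq (continuous_star'.comp (continuous_const_smul c))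
        ((continuous_const_smul (star c)).comp continuous_star')) fun a => ?_
    rw [← Completion.coe_smul, coe_star, coe_star, ← Completion.coe_smul, star_smul]

instance : CStarRing (QuantumDisk.{u} q) where
  norm_mul_self_le x := by
    refine Completion.induction_on x
      (isClosed_le (continuous_norm.mul continuous_norm)
        (continuous_norm.comp (continuous_star'.mul continuous_id))) fun a => ?_
    change ‖(a : QuantumDisk.{u} q)‖ * ‖(a : QuantumDisk.{u} q)‖
      ≤ ‖star (a : QuantumDisk.{u} q) * (a : QuantumDisk.{u} q)‖
    rw [coe_star, ← Completion.coe_mul, Completion.norm_coe, Completion.norm_coe,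
      DiskPoly.norm_star_mul_self_eq]

instance : NormedAlgebra ℂ (QuantumDisk.{u} q) where
  norm_smul_le c x := (norm_smul c x).le

instance : CStarAlgebra (QuantumDisk.{u} q) where

end QuantumDisk

/-! ### The Toeplitz algebra -/

/-- The Hilbert space `ℓ²` of square summable sequences `(x₀, x₁, x₂, …)` of complex numbers. -/
abbrev EllTwo : Type := lp (fun _ : ℕ => ℂ) 2

/-- The right shift `(x₀, x₁, …) ↦ (0, x₀, x₁, …)` of sequences. -/
def shiftSeq (x : ℕ → ℂ) : ℕ → ℂ
  | 0 => 0
  | n + 1 => x n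

theorem hasSum_shiftSeq (x : EllTwo) :
    HasSum (fun n => ‖shiftSeq x n‖ ^ (2 : ENNReal).toReal) (‖x‖ ^ (2 : ENNReal).toReal) := by
  have h := lp.hasSum_norm (p := 2) (by norm_num) x
  rw [← hasSum_nat_add_iff' 1]
  simpa [shiftSeq] using h

/-- The unilateral shift `V` on `ℓ²`, with `V eₙ = eₙ₊₁`, as a linear isometry. -/
def unilateralShiftIsometry : EllTwo →ₗᵢ[ℂ] EllTwo where
  toFun x := ⟨shiftSeq x, memℓp_gen (hasSum_shiftSeq x).summable⟩
  map_add' x y := by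
    ext n
    cases n
    · exact (add_zero (0 : ℂ)).symm
    · rfl
  map_smul' c x := by
    ext n
    cases n <;> simp [shiftSeq]
  norm_map' x := by
    have h1 := lp.hasSum_norm (p := 2) (by norm_num)
      (⟨shiftSeq x, memℓp_gen (hasSum_shiftSeq x).summable⟩ : EllTwo)
    have h2 := h1.unique (hasSum_shiftSeq x)
    exact (Real.rpow_left_inj (norm_nonneg _) (norm_nonneg _) (by norm_num)).mp h2

/-- The unilateral shift `V` as a bounded operator on `ℓ²`. -/
def unilateralShift : EllTwo →L[ℂ] EllTwo := unilateralShiftIsometry.toContinuousLinearMap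

theorem unilateralShift_single (n : ℕ) :
    unilateralShift (lp.single 2 n (1 : ℂ)) = lp.single 2 (n + 1) (1 : ℂ) := by
  ext k
  change shiftSeq (lp.single 2 n (1 : ℂ) : EllTwo) k = _
  cases k <;> simp [shiftSeq, Pi.single_apply]

/-- The Toeplitz algebra `C*(V)`: the norm-closed unital `*`-subalgebra of the bounded operators on
`ℓ²` generated by the unilateral shift. -/
abbrev ToeplitzAlgebra : Type := StarAlgebra.elemental ℂ unilateralShift

end

/-! The relation makes `star t * t` at least `1 - q > 0`, hence invertible, so every solution has a
polar form `t = s * sqrt (star t * t)` with `s` an isometry. Then `y = star t * t` satisfies `y = q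
s y s* + (1 - q)`, a contractive fixed-point equation whose only solution is `diskSeries q s`. Thus
solutions and isometries determine each other (`diskElement_relation`, `exists_eq_diskElement`), and
a closed star-subalgebra containing one contains the other (`diskElement_mem`,
`mem_of_diskElement_mem`).

It remains to see that the universal norm is attained at the weighted shift `diskElement q V`. The
input is Coburn's estimate `norm_starEval_le_unilateralShift`, obtained without constructing the
Wold decomposition. With `l x = lim ‖S*ⁿ x‖²`, truncated orbits under `S*` asymptotically intertwine
`S` with a shift of some multiplicity: compressed to `ker S*` they carry `‖x‖² - l x`, averaged over
time they carry `l x`, and the two resulting bounds add up. The estimate passes to the closed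
algebra generated by the pair `(V, S)`, hence to polynomials in its disk element. So evaluation at
the weighted shift is isometric on the quantum disk, and its closed range is `C*(V)`. -/

noncomputable section

open Filter Topology

/-! ### Evaluation of `*`-polynomials -/

section StarEval

variable {A : Type*} [Ring A] [StarRing A] [Algebra ℂ A]

/-- The value at `t` of a polynomial in `z` and `z̄`. -/
def starEval (t : A) : FreeAlgebra ℂ DiskGen →ₐ[ℂ] A :=
  FreeAlgebra.lift ℂ (fun g => match g with
    | .z => t
    | .zbar => star t)

theorem starEval_z (t : A) : starEval t (FreeAlgebra.ι ℂ .z) = t := by simp [starEval]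

theorem starEval_zbar (t : A) : starEval t (FreeAlgebra.ι ℂ .zbar) = star t := by simp [starEval]

theorem starEval_conj [StarModule ℂ A] (t : A) (a : FreeAlgebra ℂ DiskGen) :
    starEval t (freeDiskConj a).unop = star (starEval t a) := by
  induction a using FreeAlgebra.induction with
  | grade0 c =>
    rw [freeDiskConj_algebraMap, MulOpposite.unop_op, AlgHom.commutes, AlgHom.commutes,
      Algebra.algebraMap_eq_smul_one, Algebra.algebraMap_eq_smul_one, star_smul, star_one]
    rfl
  | grade1 g =>
    rw [freeDiskConj_ι, MulOpposite.unop_op]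
    cases g
    · rw [DiskGen.conj, starEval_z, starEval_zbar]
    · rw [DiskGen.conj, starEval_z, starEval_zbar, star_star]
  | mul a b ha hb => rw [map_mul, MulOpposite.unop_mul, map_mul, map_mul, ha, hb, star_mul]
  | add a b ha hb => rw [map_add, MulOpposite.unop_add, map_add, map_add, ha, hb, star_add]

theorem map_starEval {B F : Type*} [Ring B] [StarRing B] [Algebra ℂ B] [FunLike F A B]
    [AlgHomClass F ℂ A B] [StarHomClass F A B] (φ : F) (t : A) (a : FreeAlgebra ℂ DiskGen) :
    φ (starEval t a) = starEval (φ t) a := by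
  have h : (φ : A →ₐ[ℂ] B).comp (starEval t) = starEval (φ t) := by
    ext g
    cases g
    · simp [starEval_z]
    · simp [starEval_zbar, map_star]
  exact DFunLike.congr_fun h a

theorem starEval_mem [StarModule ℂ A] {M : StarSubalgebra ℂ A} {t : A} (ht : t ∈ M)
    (a : FreeAlgebra ℂ DiskGen) : starEval t a ∈ M := by
  have := map_starEval M.subtype (⟨t, ht⟩ : M) a
  rw [show M.subtype (⟨t, ht⟩ : M) = t from rfl] at this
  rw [← this]
  exact SetLike.coe_mem _

end StarEval

theorem DiskRep.eval_eq_starEval {q : ℝ} (ρ : DiskRep.{u} q) (a : FreeAlgebra ℂ DiskGen) :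
    ρ.eval a = starEval ρ.T a := by
  have h : ρ.eval = starEval ρ.T := by
    ext g : 2
    cases g
    · simp [starEval_z, ρ.eval_z]
    · simp [starEval_zbar, ρ.eval_zbar]
  rw [h]

/-- A map intertwining two operators and their adjoints intertwines all `*`-polynomials in them. -/
theorem starEval_intertwine {H K : Type*} [NormedAddCommGroup H] [InnerProductSpace ℂ H]
    [CompleteSpace H] [NormedAddCommGroup K] [InnerProductSpace ℂ K] [CompleteSpace K]
    {S : H →L[ℂ] H} {T : K →L[ℂ] K} (C : H →ₗ[ℂ] K) (h : ∀ x, C (S x) = T (C x))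
    (h' : ∀ x, C (star S x) = star T (C x)) (a : FreeAlgebra ℂ DiskGen) (x : H) :
    C (starEval S a x) = starEval T a (C x) := by
  induction a using FreeAlgebra.induction generalizing x with
  | grade0 c => simp [Algebra.algebraMap_eq_smul_one]
  | grade1 g =>
    cases g
    · simpa only [starEval_z] using h x
    · simpa only [starEval_zbar] using h' x
  | mul a b ha hb =>
    rw [map_mul, map_mul, mul_apply_eq_comp, ha, hb, mul_apply_eq_comp]
  | add a b ha hb => simp [ha, hb]

/-- Maps asymptotically intertwining two operators and their adjoints asymptotically intertwine
all `*`-polynomials in them. -/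
theorem tendsto_starEval_intertwine {H K : Type*} [NormedAddCommGroup H] [InnerProductSpace ℂ H]
    [CompleteSpace H] [NormedAddCommGroup K] [InnerProductSpace ℂ K] [CompleteSpace K]
    {S : H →L[ℂ] H} {T : K →L[ℂ] K} (C : ℕ → H →ₗ[ℂ] K)
    (h : ∀ x, Tendsto (fun n => T (C n x) - C n (S x)) atTop (𝓝 0))
    (h' : ∀ x, Tendsto (fun n => star T (C n x) - C n (star S x)) atTop (𝓝 0))
    (a : FreeAlgebra ℂ DiskGen) (x : H) :
    Tendsto (fun n => starEval T a (C n x) - C n (starEval S a x)) atTop (𝓝 0) := by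
  induction a using FreeAlgebra.induction generalizing x with
  | grade0 c => simp [Algebra.algebraMap_eq_smul_one]
  | grade1 g =>
    cases g
    · simpa only [starEval_z] using h x
    · simpa only [starEval_zbar] using h' x
  | mul a b ha hb =>
    have h1 := ((starEval T a).continuous.tendsto' 0 0 (map_zero _)).comp (hb x)
    have h2 := h1.add (ha (starEval S b x))
    rw [add_zero] at h2
    refine h2.congr fun n => ?_
    simp
  | add a b ha hb =>
    have h2 := (ha x).add (hb x)
    rw [add_zero] at h2
    refine h2.congr fun n => ?_
    simp only [map_add, add_apply]
    abel

/-! ### The shift on square summable sequences of vectors -/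

section VectorShift

variable (H : Type*) [NormedAddCommGroup H]

/-- The Hilbert space of square summable sequences of vectors of `H`. -/
abbrev SeqSpace : Type _ := lp (fun _ : ℕ => H) 2

variable {H}

/-- The right shift of sequences of vectors. -/
def vectorShiftSeq (x : ℕ → H) : ℕ → H
  | 0 => 0
  | n + 1 => x n

theorem hasSum_vectorShiftSeq (x : SeqSpace H) :
    HasSum (fun n => ‖vectorShiftSeq x n‖ ^ (2 : ENNReal).toReal)
      (‖x‖ ^ (2 : ENNReal).toReal) := by
  have h := lp.hasSum_norm (p := 2) (by norm_num) x
  rw [← hasSum_nat_add_iff' 1]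
  simpa [vectorShiftSeq] using h

theorem enorm_sq_eq_tsum (x : SeqSpace H) : ‖x‖ₑ ^ 2 = ∑' n, ‖x n‖ₑ ^ 2 := by
  have h := lp.hasSum_norm (p := 2) (by norm_num) x
  simp only [ENNReal.toReal_ofNat, Real.rpow_ofNat] at h
  have h2 := ENNReal.ofReal_tsum_of_nonneg (fun n => by positivity) h.summable
  rw [h.tsum_eq] at h2
  simpa [ENNReal.ofReal_pow, ofReal_norm] using h2

variable [InnerProductSpace ℂ H]

variable (H) in
/-- The shift on `ℓ²(ℕ, H)` as a linear isometry. -/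
def vectorShiftIsometry : SeqSpace H →ₗᵢ[ℂ] SeqSpace H where
  toFun x := ⟨vectorShiftSeq x, memℓp_gen (hasSum_vectorShiftSeq x).summable⟩
  map_add' x y := by
    ext n
    cases n
    · exact (add_zero (0 : H)).symm
    · rfl
  map_smul' c x := by
    ext n
    cases n <;> simp [vectorShiftSeq]
  norm_map' x := by
    have h1 := lp.hasSum_norm (p := 2) (by norm_num)
      (⟨vectorShiftSeq x, memℓp_gen (hasSum_vectorShiftSeq x).summable⟩ : SeqSpace H)
    have h2 := h1.unique (hasSum_vectorShiftSeq x)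
    exact (Real.rpow_left_inj (norm_nonneg _) (norm_nonneg _) (by norm_num)).mp h2

variable (H) in
/-- The shift on `ℓ²(ℕ, H)` as a bounded operator. -/
def vectorShift : SeqSpace H →L[ℂ] SeqSpace H := (vectorShiftIsometry H).toContinuousLinearMap

@[simp]
theorem vectorShift_apply_zero (x : SeqSpace H) : vectorShift H x 0 = 0 := rfl

@[simp]
theorem vectorShift_apply_succ (x : SeqSpace H) (n : ℕ) : vectorShift H x (n + 1) = x n := rfl

theorem vectorShift_single (n : ℕ) (a : H) :
    vectorShift H (lp.single 2 n a) = lp.single 2 (n + 1) a := by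
  ext k
  cases k <;> simp [Pi.single_apply]

theorem star_vectorShift_apply [CompleteSpace H] (x : SeqSpace H) (n : ℕ) :
    star (vectorShift H) x n = x (n + 1) := by
  refine ext_inner_left ℂ fun a : H => ?_
  have h : inner ℂ (lp.single 2 n a) (star (vectorShift H) x) =
      inner ℂ (lp.single 2 (n + 1) a) x := by
    rw [ContinuousLinearMap.star_eq_adjoint, ContinuousLinearMap.adjoint_inner_right,
      vectorShift_single]
  have h1 := lp.inner_single_left (𝕜 := ℂ) (G := fun _ : ℕ => H) n a (star (vectorShift H) x)
  have h2 := lp.inner_single_left (𝕜 := ℂ) (G := fun _ : ℕ => H) (n + 1) a x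
  exact h1.symm.trans (h.trans h2)

theorem unilateralShift_eq_vectorShift : unilateralShift = vectorShift ℂ := by
  ext x n
  cases n <;> rfl

theorem star_vectorShift_mul_self [CompleteSpace H] :
    star (vectorShift H) * vectorShift H = 1 := by
  ext x n
  simp [star_vectorShift_apply]

/-- The sequence of inner products with a fixed vector. -/
def coordinateSeq (h : H) : SeqSpace H →ₗ[ℂ] EllTwo where
  toFun x := ⟨fun n => inner ℂ h (x n), by
    refine memℓp_gen (Summable.of_nonneg_of_le (fun n => by positivity) (fun n => ?_)
      ((lp.hasSum_norm (p := 2) (by norm_num) (x : SeqSpace H)).summable.mul_left (‖h‖ ^ 2)))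
    have := norm_inner_le_norm (𝕜 := ℂ) h (x n)
    simp only [ENNReal.toReal_ofNat, Real.rpow_ofNat]
    rw [← mul_pow]
    gcongr⟩
  map_add' x y := by
    ext n
    exact inner_add_right _ _ _
  map_smul' c x := by
    ext n
    exact inner_smul_right _ _ _

@[simp]
theorem coordinateSeq_apply (h : H) (x : SeqSpace H) (n : ℕ) :
    coordinateSeq h x n = inner ℂ h (x n) := rfl

/-- The shift moves entries without changing them, so pairing each entry with `h` commutes with the
shift and with its adjoint. -/
theorem coordinateSeq_starEval [CompleteSpace H] (h : H) (a : FreeAlgebra ℂ DiskGen)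
    (x : SeqSpace H) : coordinateSeq h (starEval (vectorShift H) a x) =
      starEval unilateralShift a (coordinateSeq h x) := by
  rw [unilateralShift_eq_vectorShift]
  refine starEval_intertwine _ (fun x => ?_) (fun x => ?_) a x
  · ext n
    cases n <;> simp
  · ext n
    simp [star_vectorShift_apply]

theorem HilbertBasis.tsum_enorm_inner_sq {ι : Type*} (b : HilbertBasis ι ℂ H) (x : H) :
    ∑' i, ‖inner ℂ (b i) x‖ₑ ^ 2 = ‖x‖ₑ ^ 2 := by
  have h := lp.hasSum_norm (p := 2) (by norm_num) (b.repr x)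
  simp only [ENNReal.toReal_ofNat, Real.rpow_ofNat] at h
  have h2 := ENNReal.ofReal_tsum_of_nonneg (fun n => by positivity) h.summable
  rw [h.tsum_eq] at h2
  simpa [ENNReal.ofReal_pow, ofReal_norm, b.repr_apply_apply] using h2.symm

/-- Parseval in each entry. Extended nonnegative reals allow the double sum to be exchanged with no
summability condition, for a basis of any cardinality. -/
theorem tsum_enorm_coordinateSeq_sq {ι : Type*} (b : HilbertBasis ι ℂ H) (x : SeqSpace H) :
    ∑' i, ‖coordinateSeq (b i) x‖ₑ ^ 2 = ‖x‖ₑ ^ 2 := by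
  simp_rw [enorm_sq_eq_tsum, coordinateSeq_apply]
  rw [ENNReal.tsum_comm]
  simp_rw [b.tsum_enorm_inner_sq]

/-- A Hilbert basis of `H` splits `ℓ²(ℕ, H)` into copies of `ℓ²` on each of which the vector shift
acts as the unilateral shift; multiplicity does not increase the norm. -/
theorem norm_starEval_vectorShift_le [CompleteSpace H] (a : FreeAlgebra ℂ DiskGen) :
    ‖starEval (vectorShift H) a‖ ≤ ‖starEval unilateralShift a‖ := by
  refine ContinuousLinearMap.opNorm_le_bound _ (norm_nonneg _) fun x => ?_
  obtain ⟨w, b, -⟩ := exists_hilbertBasis ℂ H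
  have h : ‖starEval (vectorShift H) a x‖ₑ ^ 2 ≤ (‖starEval unilateralShift a‖ₑ * ‖x‖ₑ) ^ 2 := by
    rw [mul_pow, ← tsum_enorm_coordinateSeq_sq b, ← tsum_enorm_coordinateSeq_sq b x,
      ← ENNReal.tsum_mul_left]
    refine ENNReal.tsum_le_tsum fun i => ?_
    rw [coordinateSeq_starEval, ← mul_pow]
    gcongr
    exact ContinuousLinearMap.le_opENorm _ _
  have h2 := (ENNReal.pow_le_pow_left_iff two_ne_zero).mp h
  rw [← ofReal_norm, ← ofReal_norm, ← ofReal_norm,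
    ← ENNReal.ofReal_mul (norm_nonneg _)] at h2
  exact (ENNReal.ofReal_le_ofReal_iff (by positivity)).mp h2

end VectorShift

/-! ### Polynomials in an isometry are dominated by polynomials in the shift -/

section Isometry

variable {H : Type*} [NormedAddCommGroup H] [InnerProductSpace ℂ H]

/-- The truncated sequence `(Q x, Q R x, …, Q Rⁿ x, 0, 0, …)`. -/
def orbitSeq (Q R : H →L[ℂ] H) (n : ℕ) : H →ₗ[ℂ] SeqSpace H where
  toFun x := ∑ k ∈ Finset.range (n + 1), lp.single 2 k (Q ((R ^ k) x))
  map_add' x y := by simp [Finset.sum_add_distrib]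
  map_smul' c x := by simp [Finset.smul_sum]

theorem orbitSeq_apply (Q R : H →L[ℂ] H) (n : ℕ) (x : H) :
    orbitSeq Q R n x = ∑ k ∈ Finset.range (n + 1), lp.single 2 k (Q ((R ^ k) x)) := rfl

theorem norm_orbitSeq_sq (Q R : H →L[ℂ] H) (n : ℕ) (x : H) :
    ‖orbitSeq Q R n x‖ ^ 2 = ∑ k ∈ Finset.range (n + 1), ‖Q ((R ^ k) x)‖ ^ 2 := by
  have h := lp.norm_sum_single (E := fun _ : ℕ => H) (p := 2) (by norm_num)
    (fun k => Q ((R ^ k) x)) (Finset.range (n + 1))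
  simpa only [ENNReal.toReal_ofNat, Real.rpow_ofNat, ← orbitSeq_apply] using h

variable [CompleteSpace H]

theorem star_vectorShift_single_zero (a : H) : star (vectorShift H) (lp.single 2 0 a) = 0 := by
  ext n
  simp [star_vectorShift_apply]

theorem star_vectorShift_single_succ (n : ℕ) (a : H) :
    star (vectorShift H) (lp.single 2 (n + 1) a) = lp.single 2 n a := by
  rw [← vectorShift_single, ← mul_apply_eq_comp, star_vectorShift_mul_self]
  rfl

variable {S : H →L[ℂ] H} (hS : star S * S = 1)
include hS

/-- Since `S*ᵏ⁺¹ S = S*ᵏ`, the orbit of `S x` is that of `x` moved one place to the right; only the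
two ends of the truncation fail to match. -/
theorem vectorShift_orbitSeq (Q : H →L[ℂ] H) (n : ℕ) (x : H) :
    vectorShift H (orbitSeq Q (star S) n x) - orbitSeq Q (star S) n (S x) =
      lp.single 2 (n + 1) (Q ((star S ^ n) x)) - lp.single 2 0 (Q (S x)) := by
  have h (k : ℕ) : (star S ^ (k + 1)) (S x) = (star S ^ k) x := by
    rw [← mul_apply_eq_comp, pow_succ, mul_assoc, hS, mul_one]
  rw [orbitSeq_apply, orbitSeq_apply, map_sum, Finset.sum_range_succ, Finset.sum_range_succ']
  simp only [vectorShift_single, h, pow_zero, one_apply_eq_self]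
  abel

omit hS in
theorem star_vectorShift_orbitSeq (Q : H →L[ℂ] H) (n : ℕ) (x : H) :
    star (vectorShift H) (orbitSeq Q (star S) n x) - orbitSeq Q (star S) n (star S x) =
      - lp.single 2 n (Q ((star S ^ (n + 1)) x)) := by
  rw [orbitSeq_apply, orbitSeq_apply, map_sum, Finset.sum_range_succ', Finset.sum_range_succ]
  simp only [star_vectorShift_single_succ, star_vectorShift_single_zero, pow_succ,
    mul_apply_eq_comp]
  abel

theorem norm_apply_of_star_mul_self_eq_one (x : H) : ‖S x‖ = ‖x‖ := by
  have h : inner ℂ (S x) (S x) = inner ℂ x x := by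
    rw [← ContinuousLinearMap.adjoint_inner_right, ← ContinuousLinearMap.star_eq_adjoint,
      ← mul_apply_eq_comp, hS]
    rfl
  rw [inner_self_eq_norm_sq_to_K, inner_self_eq_norm_sq_to_K] at h
  have h2 : ‖S x‖ ^ 2 = ‖x‖ ^ 2 := by exact_mod_cast h
  exact (pow_left_inj₀ (norm_nonneg _) (norm_nonneg _) two_ne_zero).mp h2

theorem norm_star_apply_le_of_star_mul_self_eq_one (x : H) : ‖star S x‖ ≤ ‖x‖ := by
  have h : ‖S‖ ≤ 1 := ContinuousLinearMap.opNorm_le_bound _ zero_le_one fun y => by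
    rw [norm_apply_of_star_mul_self_eq_one hS, one_mul]
  rw [← norm_star] at h
  simpa using (star S).le_of_opNorm_le h x

/-- Pythagoras for the range projection `S S*`. Along an orbit of `S*` these differences telescope.
-/
theorem norm_sub_mul_star_apply_sq (x : H) :
    ‖(1 - S * star S) x‖ ^ 2 = ‖x‖ ^ 2 - ‖star S x‖ ^ 2 := by
  have h := norm_sub_sq (𝕜 := ℂ) x (S (star S x))
  have h2 : inner ℂ x (S (star S x)) = inner ℂ (star S x) (star S x) := by
    rw [ContinuousLinearMap.star_eq_adjoint, ContinuousLinearMap.adjoint_inner_left]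
  rw [h2, norm_apply_of_star_mul_self_eq_one hS, inner_self_eq_norm_sq] at h
  rw [sub_apply, one_apply_eq_self, mul_apply_eq_comp, h]
  ring

/-- The squared norm of the unitary part of a vector in the Wold decomposition. -/
theorem exists_tendsto_norm_star_pow_sq (x : H) :
    ∃ l : ℝ, Tendsto (fun n => ‖(star S ^ n) x‖ ^ 2) atTop (𝓝 l) := by
  refine ⟨_, tendsto_atTop_ciInf (antitone_nat_of_succ_le fun n => ?_) ⟨0, ?_⟩⟩
  · rw [pow_succ' (star S), mul_apply_eq_comp]
    gcongr
    exact norm_star_apply_le_of_star_mul_self_eq_one hS _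
  · rintro _ ⟨n, rfl⟩
    positivity

omit hS in
/-- Polynomials in the shift dominate those in an operator asymptotically intertwined with it, on
limits of the squared norms of the images. -/
theorem le_of_tendsto_norm_intertwine {C : ℕ → H →ₗ[ℂ] SeqSpace H}
    (h : ∀ x, Tendsto (fun n => vectorShift H (C n x) - C n (S x)) atTop (𝓝 0))
    (h' : ∀ x, Tendsto (fun n => star (vectorShift H) (C n x) - C n (star S x)) atTop (𝓝 0))
    (a : FreeAlgebra ℂ DiskGen) (x : H) {l m : ℝ}
    (hl : Tendsto (fun n => ‖C n x‖ ^ 2) atTop (𝓝 l))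
    (hm : Tendsto (fun n => ‖C n (starEval S a x)‖ ^ 2) atTop (𝓝 m)) :
    m ≤ ‖starEval (vectorShift H) a‖ ^ 2 * l := by
  have h0 := (tendsto_starEval_intertwine C h h' a x).norm
  rw [norm_zero] at h0
  have hl' : Tendsto (fun n => ‖C n x‖) atTop (𝓝 √l) := by
    refine ((Real.continuous_sqrt.tendsto l).comp hl).congr fun n => ?_
    exact Real.sqrt_sq (norm_nonneg _)
  have hl0 : 0 ≤ l := ge_of_tendsto' hl fun n => by positivity
  have key := ((hl'.const_mul ‖starEval (vectorShift H) a‖).add h0).pow 2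
  rw [add_zero, mul_pow, Real.sq_sqrt hl0] at key
  refine le_of_tendsto_of_tendsto' hm key fun n => ?_
  gcongr
  have h1 := norm_sub_norm_le (C n (starEval S a x)) (starEval (vectorShift H) a (C n x))
  rw [norm_sub_rev] at h1
  have h2 := (starEval (vectorShift H) a).le_opNorm (C n x)
  linarith

/-- The scalars `c n` let one lemma serve both the compressed orbits (`c = 1`) and the time-averaged
ones (`c n = (n + 1)^(-1/2)`). -/
theorem tendsto_orbitSeq_defect (Q : H →L[ℂ] H) (c : ℕ → ℂ)
    (h0 : ∀ x, Tendsto (fun n => c n • Q (S x)) atTop (𝓝 0))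
    (h : ∀ x, Tendsto (fun n => c n • Q ((star S ^ n) x)) atTop (𝓝 0)) (x : H) :
    Tendsto (fun n => vectorShift H ((c n • orbitSeq Q (star S) n) x) -
      (c n • orbitSeq Q (star S) n) (S x)) atTop (𝓝 0) := by
  rw [tendsto_zero_iff_norm_tendsto_zero]
  have := (h x).norm.add (h0 x).norm
  rw [norm_zero, add_zero] at this
  refine squeeze_zero (fun n => norm_nonneg _) (fun n => ?_) this
  rw [LinearMap.smul_apply, LinearMap.smul_apply, map_smul, ← smul_sub, vectorShift_orbitSeq hS,
    smul_sub, ← lp.single_smul, ← lp.single_smul]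
  refine (norm_sub_le _ _).trans ?_
  rw [lp.norm_single (by norm_num), lp.norm_single (by norm_num)]

omit hS in
theorem tendsto_star_orbitSeq_defect (Q : H →L[ℂ] H) (c : ℕ → ℂ)
    (h : ∀ x, Tendsto (fun n => c n • Q ((star S ^ n) x)) atTop (𝓝 0)) (x : H) :
    Tendsto (fun n => star (vectorShift H) ((c n • orbitSeq Q (star S) n) x) -
      (c n • orbitSeq Q (star S) n) (star S x)) atTop (𝓝 0) := by
  rw [tendsto_zero_iff_norm_tendsto_zero]
  have := (h (star S x)).norm
  rw [norm_zero] at this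
  refine this.congr fun n => ?_
  rw [LinearMap.smul_apply, LinearMap.smul_apply, map_smul, ← smul_sub,
    star_vectorShift_orbitSeq, smul_neg, norm_neg, ← lp.single_smul, lp.norm_single (by norm_num),
    pow_succ, mul_apply_eq_comp]

/-- **Coburn's estimate**: `*`-polynomials in an isometry are dominated in norm by the same
`*`-polynomials in the unilateral shift. -/
theorem norm_starEval_le_unilateralShift (a : FreeAlgebra ℂ DiskGen) :
    ‖starEval S a‖ ≤ ‖starEval unilateralShift a‖ := by
  refine le_trans ?_ (norm_starEval_vectorShift_le (H := H) a)
  refine ContinuousLinearMap.opNorm_le_bound _ (norm_nonneg _) fun x => ?_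
  choose l hl using exists_tendsto_norm_star_pow_sq hS
  have hR (n : ℕ) (x : H) : ‖(star S ^ n) x‖ ≤ ‖x‖ := by
    induction n with
    | zero => simp
    | succ n ih =>
      rw [pow_succ', mul_apply_eq_comp]
      exact (norm_star_apply_le_of_star_mul_self_eq_one hS _).trans ih
  -- The projection onto `ker S*`, the wandering subspace of the isometry.
  set P : H →L[ℂ] H := 1 - S * star S with hP
  have hP2 (n : ℕ) (x : H) : ‖P ((star S ^ n) x)‖ ^ 2 =
      ‖(star S ^ n) x‖ ^ 2 - ‖(star S ^ (n + 1)) x‖ ^ 2 := by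
    rw [hP, norm_sub_mul_star_apply_sq hS, pow_succ' (star S), mul_apply_eq_comp]
  have hP0 (x : H) : P (S x) = 0 := by
    rw [← mul_apply_eq_comp, hP, sub_mul, mul_assoc, hS]
    simp
  have hPt (x : H) : Tendsto (fun n => P ((star S ^ n) x)) atTop (𝓝 0) := by
    have h1 := (hl x).sub ((hl x).comp (tendsto_add_atTop_nat 1))
    rw [sub_self] at h1
    rw [tendsto_zero_iff_norm_tendsto_zero]
    have h2 := (Real.continuous_sqrt.tendsto 0).comp h1
    rw [Real.sqrt_zero] at h2
    refine h2.congr fun n => ?_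
    simp only [Function.comp_apply]
    rw [← hP2, Real.sqrt_sq (norm_nonneg _)]
  -- With `Q = P` the squared norms telescope to `‖y‖² - ‖S*ⁿ⁺¹ y‖²`, and the boundary terms vanish
  -- because `P S = 0` and `P S*ⁿ y → 0`.
  have shiftPart : ‖starEval S a x‖ ^ 2 - l (starEval S a x) ≤
      ‖starEval (vectorShift H) a‖ ^ 2 * (‖x‖ ^ 2 - l x) := by
    have hC (y : H) : Tendsto (fun n => ‖((1 : ℂ) • orbitSeq P (star S) n) y‖ ^ 2) atTop
        (𝓝 (‖y‖ ^ 2 - l y)) := by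
      refine (((hl y).comp (tendsto_add_atTop_nat 1)).const_sub (‖y‖ ^ 2)).congr fun n => ?_
      rw [one_smul, norm_orbitSeq_sq]
      simp_rw [hP2]
      rw [Finset.sum_range_sub' (fun k => ‖(star S ^ k) y‖ ^ 2)]
      simp
    refine le_of_tendsto_norm_intertwine (C := fun n => (1 : ℂ) • orbitSeq P (star S) n)
      (tendsto_orbitSeq_defect hS P (fun _ => 1) ?_ ?_)
      (tendsto_star_orbitSeq_defect P (fun _ => 1) ?_) a x (hC x) (hC _)
    · simp [hP0]
    · simpa using hPt
    · simpa using hPt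
  -- With `Q = 1` the boundary terms are only bounded, so the factor `(n + 1)^(-1/2)` is needed to
  -- kill them; it turns the squared norms into Cesàro means of `‖S*ᵏ y‖²`, which still tend to `l
  -- y`.
  have unitaryPart : l (starEval S a x) ≤ ‖starEval (vectorShift H) a‖ ^ 2 * l x := by
    set c : ℕ → ℂ := fun n => ((√(n + 1 : ℝ))⁻¹ : ℝ) with hc
    have hcn (n : ℕ) : ‖c n‖ = (√(n + 1 : ℝ))⁻¹ := by
      rw [hc, Complex.norm_real, Real.norm_of_nonneg (by positivity)]
    have hc0 : Tendsto (fun n => ‖c n‖) atTop (𝓝 0) := by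
      simp_rw [hcn]
      refine tendsto_inv_atTop_zero.comp (Real.tendsto_sqrt_atTop.comp ?_)
      exact tendsto_atTop_add_const_right _ _ tendsto_natCast_atTop_atTop
    have hcb (y : ℕ → H) (r : ℝ) (hy : ∀ n, ‖y n‖ ≤ r) :
        Tendsto (fun n => c n • y n) atTop (𝓝 0) := by
      rw [tendsto_zero_iff_norm_tendsto_zero]
      have h1 := hc0.mul_const r
      rw [zero_mul] at h1
      refine squeeze_zero (fun n => norm_nonneg _) (fun n => ?_) h1
      rw [norm_smul]
      gcongr
      exact hy n
    have hC (y : H) : Tendsto (fun n => ‖(c n • orbitSeq 1 (star S) n) y‖ ^ 2) atTop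
        (𝓝 (l y)) := by
      refine ((hl y).cesaro.comp (tendsto_add_atTop_nat 1)).congr fun n => ?_
      rw [LinearMap.smul_apply, norm_smul, mul_pow, norm_orbitSeq_sq, hcn, inv_pow,
        Real.sq_sqrt (by positivity)]
      simp
    refine le_of_tendsto_norm_intertwine (C := fun n => c n • orbitSeq 1 (star S) n)
      (tendsto_orbitSeq_defect hS 1 c ?_ ?_)
      (tendsto_star_orbitSeq_defect 1 c ?_) a x (hC x) (hC _)
    · exact fun y => hcb _ _ fun n => le_rfl
    · exact fun y => hcb _ _ fun n => hR n y
    · exact fun y => hcb _ _ fun n => hR n y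
  have h : ‖starEval S a x‖ ^ 2 ≤ (‖starEval (vectorShift H) a‖ * ‖x‖) ^ 2 := by
    rw [mul_pow]
    linarith
  exact (pow_le_pow_iff_left₀ (norm_nonneg _) (by positivity) two_ne_zero).mp h

end Isometry

/-! ### Isometries and solutions of the disk relation -/

section DiskRelation

variable {A : Type*} [CStarAlgebra A]

theorem CStarAlgebra.norm_one_le : ‖(1 : A)‖ ≤ 1 := by
  cases subsingleton_or_nontrivial A
  · rw [Subsingleton.elim (1 : A) 0, norm_zero]
    exact zero_le_one
  · exact CStarRing.norm_one.le

/-- The element `(1 - q) ∑ qᵏ sᵏ s*ᵏ`. -/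
def diskSeries (q : ℝ) (s : A) : A := ∑' k : ℕ, ((1 - q) * q ^ k) • (s ^ k * star (s ^ k))

variable {q : ℝ} {s : A}

theorem star_pow_mul_pow_eq_one (hs : star s * s = 1) (k : ℕ) : star (s ^ k) * s ^ k = 1 := by
  induction k with
  | zero => simp
  | succ k ih =>
    rw [pow_succ, star_mul, mul_assoc, ← mul_assoc _ (s ^ k), ih, one_mul, hs]

theorem summable_diskSeries (hq0 : 0 ≤ q) (hq1 : q < 1) (hs : star s * s = 1) :
    Summable fun k : ℕ => ((1 - q) * q ^ k) • (s ^ k * star (s ^ k)) := by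
  refine Summable.of_norm_bounded
    (((summable_geometric_of_lt_one hq0 hq1).mul_left (1 - q)).mul_right ‖(1 : A)‖) fun k => ?_
  have : 0 ≤ 1 - q := by linarith
  rw [norm_smul, Real.norm_of_nonneg (by positivity), CStarRing.norm_self_mul_star,
    ← CStarRing.norm_star_mul_self, star_pow_mul_pow_eq_one hs]

theorem diskSeries_eq (hq0 : 0 ≤ q) (hq1 : q < 1) (hs : star s * s = 1) :
    diskSeries q s = q • (s * diskSeries q s * star s) + (1 - q) • 1 := by
  have h := summable_diskSeries hq0 hq1 hs
  conv_lhs => rw [diskSeries, h.tsum_eq_zero_add]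
  rw [diskSeries, ← h.tsum_mul_left, ← (h.mul_left s).tsum_mul_right, add_comm,
    ← ((h.mul_left s).mul_right (star s)).tsum_const_smul]
  congr 1
  · refine tsum_congr fun k => ?_
    rw [mul_smul_comm, smul_mul_assoc, smul_smul, pow_succ' s, star_mul]
    simp only [mul_assoc]
    congr 1
    ring
  · simp

/-- As `‖s‖ ≤ 1`, the map `y ↦ q s y s* + (1 - q)` contracts by the factor `q < 1`, so it has at
most one fixed point. -/
theorem eq_diskSeries (hq0 : 0 ≤ q) (hq1 : q < 1) (hs : star s * s = 1) {y : A}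
    (hy : y = q • (s * y * star s) + (1 - q) • 1) : y = diskSeries q s := by
  have h : y - diskSeries q s = q • (s * (y - diskSeries q s) * star s) := by
    conv_lhs => rw [hy, diskSeries_eq hq0 hq1 hs]
    rw [mul_sub, sub_mul, smul_sub]
    abel
  set d := y - diskSeries q s with hd
  have hn : ‖d‖ ≤ q * ‖d‖ := by
    conv_lhs => rw [h]
    rw [norm_smul, Real.norm_of_nonneg hq0]
    gcongr
    have h1 : ‖s‖ * ‖s‖ ≤ 1 := by
      rw [← CStarRing.norm_star_mul_self, hs]
      exact CStarAlgebra.norm_one_le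
    calc ‖s * d * star s‖ ≤ ‖s‖ * ‖d‖ * ‖star s‖ :=
          (norm_mul_le _ _).trans (by gcongr; exact norm_mul_le _ _)
      _ = (‖s‖ * ‖s‖) * ‖d‖ := by rw [norm_star]; ring
      _ ≤ 1 * ‖d‖ := by gcongr
      _ = ‖d‖ := one_mul _
  have h0 : ‖d‖ = 0 := by nlinarith [norm_nonneg d]
  exact sub_eq_zero.mp (norm_eq_zero.mp h0)

theorem diskSeries_mem (hq0 : 0 ≤ q) (hq1 : q < 1) (hs : star s * s = 1)
    {M : StarSubalgebra ℂ A} (hM : IsClosed (M : Set A)) (h : s ∈ M) : diskSeries q s ∈ M := by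
  refine hM.mem_of_tendsto (summable_diskSeries hq0 hq1 hs).hasSum.tendsto_sum_nat
    (Eventually.of_forall fun n => sum_mem fun k _ => ?_)
  rw [← Complex.coe_smul]
  exact M.smul_mem (mul_mem (pow_mem h k) (star_mem (pow_mem h k))) _

variable [PartialOrder A] [StarOrderedRing A]

theorem diskSeries_nonneg (hq0 : 0 ≤ q) (hq1 : q < 1) : 0 ≤ diskSeries q s := by
  refine tsum_nonneg fun k => smul_nonneg ?_ (mul_star_self_nonneg _)
  have : 0 ≤ 1 - q := by linarith
  positivity

theorem isStrictlyPositive_of_eq_add_smul_one {x y : A} (hq1 : q < 1) (hx : 0 ≤ x)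
    (hy : y = x + (1 - q) • 1) : IsStrictlyPositive y := by
  rw [hy]
  exact IsStrictlyPositive.nonneg_add hx (isStrictlyPositive_one.smul (by linarith))

theorem isStrictlyPositive_diskSeries (hq0 : 0 ≤ q) (hq1 : q < 1) (hs : star s * s = 1) :
    IsStrictlyPositive (diskSeries q s) := by
  refine isStrictlyPositive_of_eq_add_smul_one hq1 (smul_nonneg hq0 ?_) (diskSeries_eq hq0 hq1 hs)
  exact star_right_conjugate_nonneg (diskSeries_nonneg hq0 hq1) s

/-- The solution of the disk relation with polar part `s`. -/
def diskElement (q : ℝ) (s : A) : A := s * CFC.sqrt (diskSeries q s)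

theorem star_sqrt (x : A) : star (CFC.sqrt x) = CFC.sqrt x :=
  (IsSelfAdjoint.of_nonneg (CFC.sqrt_nonneg x)).star_eq

theorem star_diskElement_mul_self (hq0 : 0 ≤ q) (hq1 : q < 1) (hs : star s * s = 1) :
    star (diskElement q s) * diskElement q s = diskSeries q s := by
  rw [diskElement, star_mul, star_sqrt, mul_assoc, ← mul_assoc (star s), hs, one_mul,
    CFC.sqrt_mul_sqrt_self _ (diskSeries_nonneg hq0 hq1)]

theorem diskElement_mul_star_self (hq0 : 0 ≤ q) (hq1 : q < 1) :
    diskElement q s * star (diskElement q s) = s * diskSeries q s * star s := by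
  rw [diskElement, star_mul, star_sqrt, mul_assoc, ← mul_assoc (CFC.sqrt _),
    CFC.sqrt_mul_sqrt_self _ (diskSeries_nonneg hq0 hq1), mul_assoc]

theorem diskElement_relation (hq0 : 0 ≤ q) (hq1 : q < 1) (hs : star s * s = 1) :
    star (diskElement q s) * diskElement q s =
      (q : ℂ) • (diskElement q s * star (diskElement q s)) + ((1 - q : ℝ) : ℂ) • 1 := by
  rw [star_diskElement_mul_self hq0 hq1 hs, diskElement_mul_star_self hq0 hq1,
    Complex.coe_smul, Complex.coe_smul, ← diskSeries_eq hq0 hq1 hs]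

/-- Every solution of the disk relation comes from an isometry. -/
theorem exists_eq_diskElement (hq0 : 0 ≤ q) (hq1 : q < 1) {t : A}
    (ht : star t * t = (q : ℂ) • (t * star t) + ((1 - q : ℝ) : ℂ) • 1) :
    ∃ s : A, star s * s = 1 ∧ diskElement q s = t := by
  rw [Complex.coe_smul, Complex.coe_smul] at ht
  have hpos : IsStrictlyPositive (star t * t) :=
    isStrictlyPositive_of_eq_add_smul_one hq1 (smul_nonneg hq0 (mul_star_self_nonneg t)) ht
  have h0 : 0 ≤ star t * t := star_mul_self_nonneg t
  obtain ⟨r, hr⟩ := hpos.isUnit_cfcSqrt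
  have hrr : (r : A) * r = star t * t := by rw [hr, CFC.sqrt_mul_sqrt_self _ h0]
  have hrs : star (r : A) = r := by rw [hr, star_sqrt]
  have hri : star ((r⁻¹ : Aˣ) : A) = (r⁻¹ : Aˣ) := by
    rw [← Units.coe_star_inv, show star r = r from Units.ext hrs]
  have hs : star (t * (r⁻¹ : Aˣ)) * (t * (r⁻¹ : Aˣ)) = 1 := by
    rw [star_mul, hri, mul_assoc, ← mul_assoc (star t), ← hrr, mul_assoc, Units.mul_inv, mul_one,
      Units.inv_mul]
  -- For `s = t r⁻¹` and `r² = star t * t` one has `s (star t * t) s* = t t*`, so the disk relation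
  -- is exactly the fixed-point equation.
  have hX : star t * t = diskSeries q (t * (r⁻¹ : Aˣ)) := by
    refine eq_diskSeries hq0 hq1 hs ?_
    have : t * (r⁻¹ : Aˣ) * (star t * t) * star (t * (r⁻¹ : Aˣ)) = t * star t := by
      rw [star_mul, hri, ← hrr]
      simp [mul_assoc]
    rw [this]
    exact ht
  exact ⟨t * (r⁻¹ : Aˣ), hs, by rw [diskElement, ← hX, ← hr, mul_assoc, Units.inv_mul, mul_one]⟩

theorem cfc_nnreal_mem {M : StarSubalgebra ℂ A} (hM : IsClosed (M : Set A)) {x : A} (hx : 0 ≤ x)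
    (f : NNReal → NNReal) (h : x ∈ M) : cfc f x ∈ M := by
  rw [cfc_nnreal_eq_real f x hx]
  have := hM
  exact cfc_mem (𝕜' := ℂ) (s := M) _ h

theorem diskElement_mem (hq0 : 0 ≤ q) (hq1 : q < 1) (hs : star s * s = 1)
    {M : StarSubalgebra ℂ A} (hM : IsClosed (M : Set A)) (h : s ∈ M) : diskElement q s ∈ M := by
  refine mul_mem h ?_
  rw [CFC.sqrt_eq_cfc]
  exact cfc_nnreal_mem hM (diskSeries_nonneg hq0 hq1) _ (diskSeries_mem hq0 hq1 hs hM h)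

/-- With `t = diskElement q s`, the isometry is recovered as `t (t* t)^(-1/2)`; strict positivity
makes the negative power a genuine inverse of the square root. -/
theorem mem_of_diskElement_mem (hq0 : 0 ≤ q) (hq1 : q < 1) (hs : star s * s = 1)
    {M : StarSubalgebra ℂ A} (hM : IsClosed (M : Set A)) (h : diskElement q s ∈ M) : s ∈ M := by
  have hX : diskSeries q s ∈ M := by
    rw [← star_diskElement_mul_self hq0 hq1 hs]
    exact mul_mem (star_mem h) h
  have hpos := isStrictlyPositive_diskSeries hq0 hq1 hs
  have : s = diskElement q s * (diskSeries q s) ^ (-(1 / 2) : ℝ) := by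
    rw [diskElement, CFC.sqrt_eq_rpow, mul_assoc, CFC.rpow_mul_rpow_neg _ hpos, mul_one]
  rw [this]
  exact mul_mem h (cfc_nnreal_mem hM hpos.nonneg _ hX)

/-- Uniqueness of the fixed point identifies the series componentwise, and the square root is
compatible with products. -/
theorem diskElement_prod {B : Type*} [CStarAlgebra B] [PartialOrder B] [StarOrderedRing B]
    (hq0 : 0 ≤ q) (hq1 : q < 1) (hs : star s * s = 1) {s' : B} (hs' : star s' * s' = 1) :
    diskElement q (s, s') = (diskElement q s, diskElement q s') := by
  have h : star (s, s') * (s, s') = 1 := Prod.ext hs hs'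
  have hX : (diskSeries q s, diskSeries q s') = diskSeries q (s, s') :=
    eq_diskSeries hq0 hq1 h
      (Prod.ext (diskSeries_eq hq0 hq1 hs) (diskSeries_eq hq0 hq1 hs'))
  rw [diskElement, ← hX,
    CFC.sqrt_map_prod (diskSeries_nonneg hq0 hq1) (diskSeries_nonneg hq0 hq1)]
  rfl

end DiskRelation

/-! ### Comparison of arbitrary solutions with the weighted shift. -/

theorem star_unilateralShift_mul_self : star unilateralShift * unilateralShift = 1 := by
  rw [unilateralShift_eq_vectorShift]
  exact star_vectorShift_mul_self

theorem exists_starEval_eq_of_mem_adjoin {A : Type*} [Ring A] [StarRing A] [Algebra ℂ A]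
    [StarModule ℂ A] {t x : A} (hx : x ∈ StarAlgebra.adjoin ℂ {t}) : ∃ p, starEval t p = x := by
  rw [← StarSubalgebra.mem_toSubalgebra, StarAlgebra.adjoin_toSubalgebra] at hx
  have hle : Algebra.adjoin ℂ ({t} ∪ star {t}) ≤ (starEval t).range := by
    refine Algebra.adjoin_le ?_
    rintro y (rfl | hy)
    · exact ⟨_, starEval_z y⟩
    · exact ⟨_, (starEval_zbar t).trans (by rw [← Set.mem_singleton_iff.mp hy, star_star])⟩
  exact hle hx

/-- The norm of a polynomial in an arbitrary solution of the disk relation is dominated by the norm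
of the polynomial in the weighted shift. -/
theorem norm_starEval_le_diskElement_unilateralShift {H : Type*} [NormedAddCommGroup H]
    [InnerProductSpace ℂ H] [CompleteSpace H] {q : ℝ} (hq0 : 0 ≤ q) (hq1 : q < 1) {T : H →L[ℂ] H}
    (hT : star T * T = (q : ℂ) • (T * star T) + ((1 - q : ℝ) : ℂ) • 1)
    (a : FreeAlgebra ℂ DiskGen) :
    ‖starEval T a‖ ≤ ‖starEval (diskElement q unilateralShift) a‖ := by
  obtain ⟨S, hS, rfl⟩ := exists_eq_diskElement hq0 hq1 hT
  -- The disk element is not a polynomial in the isometry, so Coburn's estimate is read as a closed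
  -- condition on pairs: it extends from polynomials in `W` to the C*-algebra of `W`, which contains
  -- `diskElement q W`.
  set W : (EllTwo →L[ℂ] EllTwo) × (H →L[ℂ] H) := (unilateralShift, S) with hW
  have hV := star_unilateralShift_mul_self
  have hWW : star W * W = 1 := Prod.ext hV hS
  have fst_eval (t : (EllTwo →L[ℂ] EllTwo) × (H →L[ℂ] H)) (p : FreeAlgebra ℂ DiskGen) :
      (starEval t p).1 = starEval t.1 p := map_starEval (StarAlgHom.fst ℂ _ _) t p
  have snd_eval (t : (EllTwo →L[ℂ] EllTwo) × (H →L[ℂ] H)) (p : FreeAlgebra ℂ DiskGen) :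
      (starEval t p).2 = starEval t.2 p := map_starEval (StarAlgHom.snd ℂ _ _) t p
  have hclosed : IsClosed {x : (EllTwo →L[ℂ] EllTwo) × (H →L[ℂ] H) | ‖x.2‖ ≤ ‖x.1‖} :=
    isClosed_le continuous_snd.norm continuous_fst.norm
  have hle : ∀ x ∈ StarAlgebra.elemental ℂ W, ‖x.2‖ ≤ ‖x.1‖ := by
    refine closure_minimal (fun x hx => ?_) hclosed
    obtain ⟨p, rfl⟩ := exists_starEval_eq_of_mem_adjoin hx
    change ‖(starEval W p).2‖ ≤ ‖(starEval W p).1‖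
    rw [fst_eval, snd_eval]
    exact norm_starEval_le_unilateralShift hS p
  have h := hle _ (starEval_mem (diskElement_mem hq0 hq1 hWW
    (StarAlgebra.elemental.isClosed ℂ W) (StarAlgebra.elemental.self_mem ℂ W)) a)
  rw [fst_eval, snd_eval, hW, diskElement_prod hq0 hq1 hV hS] at h
  exact h

/-! ### The isomorphism of the quantum disk with the Toeplitz algebra -/

/-- Lifts `ℓ²` to the universe over which the representations range. -/
instance {E : Type*} [NormedAddCommGroup E] [InnerProductSpace ℂ E] :
    InnerProductSpace ℂ (ULift.{u} E) where
  inner x y := inner ℂ x.down y.down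
  norm_sq_eq_re_inner x := norm_sq_eq_re_inner x.down
  conj_inner_symm x y := inner_conj_symm x.down y.down
  add_left x y z := inner_add_left x.down y.down z.down
  smul_left x y c := inner_smul_left x.down y.down c

theorem norm_starAlgEquiv_apply {A B : Type*} [CStarAlgebra A] [CStarAlgebra B] (e : A ≃⋆ₐ[ℂ] B)
    (x : A) : ‖e x‖ = ‖x‖ :=
  NonUnitalStarAlgHom.norm_map e e.injective x

namespace QuantumDisk

variable {q : Set.Ico (0 : ℝ) 1}

/-- The representation of the disk relation on `ℓ²` by a weighted shift. -/
def weightedShiftRep (q : Set.Ico (0 : ℝ) 1) : DiskRep.{u} (q : ℝ) where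
  H := ULift.{u} EllTwo
  T := (LinearIsometryEquiv.ulift ℂ EllTwo).symm.conjStarAlgEquiv
    (diskElement (q : ℝ) unilateralShift)
  rel := by
    rw [← map_star, ← map_mul, diskElement_relation q.2.1 q.2.2 star_unilateralShift_mul_self,
      map_add, map_smul, map_smul, map_mul, map_one]

theorem norm_eval_weightedShiftRep (a : FreeAlgebra ℂ DiskGen) :
    ‖(weightedShiftRep.{u} q).eval a‖ =
      ‖starEval (diskElement (q : ℝ) unilateralShift) a‖ := by
  rw [DiskRep.eval_eq_starEval]
  let e := (LinearIsometryEquiv.ulift ℂ EllTwo : ULift.{u} EllTwo ≃ₗᵢ[ℂ] EllTwo).symm.conjStarAlgEquiv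
  have h : starEval (e (diskElement (q : ℝ) unilateralShift)) a = e (starEval _ a) :=
    (map_starEval e _ a).symm
  exact (congrArg norm h).trans (norm_starAlgEquiv_apply e _)

/-- The weighted shift is itself one of the representations in the supremum, and it dominates all
the others. -/
theorem norm_starEval_weightedShift (a : DiskPoly.{u} q) :
    ‖starEval (diskElement (q : ℝ) unilateralShift) a‖ = ‖a‖ := by
  apply le_antisymm
  · exact (norm_eval_weightedShiftRep.{u} a).symm.trans_le
      (DiskPoly.norm_eval_le (weightedShiftRep.{u} q) a)
  · exact DiskPoly.norm_le fun ρ => (congrArg norm (ρ.eval_eq_starEval a)).trans_le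
      (norm_starEval_le_diskElement_unilateralShift q.2.1 q.2.2 ρ.rel a)

variable (q) in
/-- Evaluation of polynomials at the weighted shift. -/
def evalWeightedShift : DiskPoly.{u} q →ₐ[ℂ] (EllTwo →L[ℂ] EllTwo) :=
  starEval (diskElement (q : ℝ) unilateralShift)

theorem isometry_evalWeightedShift : Isometry (evalWeightedShift.{u} q) :=
  AddMonoidHomClass.isometry_of_norm _ norm_starEval_weightedShift

theorem evalWeightedShift_star (a : DiskPoly.{u} q) :
    evalWeightedShift q (star a) = star (evalWeightedShift q a) :=
  starEval_conj _ a

variable (q) in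
/-- The representation of the quantum disk on `ℓ²` by the weighted shift. -/
def toOperators : QuantumDisk.{u} q →⋆ₐ[ℂ] (EllTwo →L[ℂ] EllTwo) where
  __ := Completion.extensionHom (evalWeightedShift.{u} q).toRingHom
    isometry_evalWeightedShift.continuous
  commutes' c := by
    refine (Completion.extensionHom_coe (evalWeightedShift.{u} q).toRingHom
      isometry_evalWeightedShift.continuous (algebraMap ℂ (DiskPoly.{u} q) c)).trans ?_
    exact (evalWeightedShift.{u} q).commutes c
  map_star' x := by
    refine Completion.induction_on x (isClosed_eq
      (Completion.continuous_extension.comp continuous_star')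
      (continuous_star.comp Completion.continuous_extension)) fun a => ?_
    rw [coe_star]
    refine (Completion.extensionHom_coe (evalWeightedShift.{u} q).toRingHom
      isometry_evalWeightedShift.continuous (star a)).trans ?_
    refine (evalWeightedShift_star a).trans (congrArg star ?_)
    exact (Completion.extensionHom_coe (evalWeightedShift.{u} q).toRingHom
      isometry_evalWeightedShift.continuous a).symm

theorem toOperators_coe (a : DiskPoly.{u} q) :
    toOperators q (a : QuantumDisk.{u} q) = evalWeightedShift q a :=
  Completion.extensionHom_coe (evalWeightedShift.{u} q).toRingHom
    isometry_evalWeightedShift.continuous a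

theorem isometry_toOperators : Isometry (toOperators.{u} q) :=
  isometry_evalWeightedShift.completion_extension

theorem isClosed_range_toOperators :
    IsClosed ((toOperators.{u} q).range : Set (EllTwo →L[ℂ] EllTwo)) := by
  exact isometry_toOperators.isClosedEmbedding.isClosed_range

theorem range_toOperators :
    (toOperators.{u} q).range = StarAlgebra.elemental ℂ unilateralShift := by
  have hclosed := StarAlgebra.elemental.isClosed ℂ unilateralShift
  apply le_antisymm
  · rintro _ ⟨x, rfl⟩
    refine Completion.induction_on x
      (hclosed.preimage isometry_toOperators.continuous) fun a => ?_
    change toOperators q (a : QuantumDisk.{u} q) ∈ StarAlgebra.elemental ℂ unilateralShift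
    rw [toOperators_coe]
    exact starEval_mem (diskElement_mem q.2.1 q.2.2 star_unilateralShift_mul_self hclosed
      (StarAlgebra.elemental.self_mem ℂ _)) a
  -- The range is closed and contains the weighted shift, the image of `z`; hence it contains the
  -- polar part `V`.
  · refine StarAlgebra.elemental.le_of_mem isClosed_range_toOperators
      (mem_of_diskElement_mem q.2.1 q.2.2 star_unilateralShift_mul_self
        isClosed_range_toOperators ?_)
    let z : DiskPoly.{u} q := FreeAlgebra.ι ℂ DiskGen.z
    exact ⟨(z : QuantumDisk.{u} q), (toOperators_coe z).trans (starEval_z _)⟩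

theorem nonempty_starAlgEquiv_toeplitzAlgebra (q : Set.Ico (0 : ℝ) 1) :
    Nonempty (QuantumDisk.{u} q ≃⋆ₐ[ℂ] ToeplitzAlgebra) := by
  have e := StarAlgEquiv.ofInjective (toOperators.{u} q) isometry_toOperators.injective
  rw [range_toOperators] at e
  exact ⟨e⟩

end QuantumDisk

end

theorem mainTheorem5 :
    (∀ q : Set.Ico (0 : ℝ) 1, Nonempty (QuantumDisk.{u} q ≃⋆ₐ[ℂ] ToeplitzAlgebra)) ∧
    (∀ q q' : Set.Ico (0 : ℝ) 1, Nonempty (QuantumDisk.{u} q ≃⋆ₐ[ℂ] QuantumDisk.{u} q')) := by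
  refine ⟨QuantumDisk.nonempty_starAlgEquiv_toeplitzAlgebra, fun q q' => ?_⟩
  obtain ⟨e⟩ := QuantumDisk.nonempty_starAlgEquiv_toeplitzAlgebra.{u} q
  obtain ⟨e'⟩ := QuantumDisk.nonempty_starAlgEquiv_toeplitzAlgebra.{u} q'
  exact ⟨e.trans e'.symm⟩
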